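/- For $k\in\mathbb N$, a $k$-dimensional vector addition system with states ($k$-VASS) $V$ consists of a finite alphabet $\Sigma$, a finite set $Q$ of states, an initial configuration $c_0\in Q\times\mathbb N^k$, a finite set $F\subseteq Q\times\mathbb N^k$ of final configurations, and a finite transition relation $\delta\subseteq Q\times\Sigma\times\mathbb Z^k\times Q$. A transition $(s,a,v,s')\in\delta$ reads the letter $a$; it can be fired in a configuration $(q,u)\in Q\times\mathbb N^k$ if and only if $q=s$ and $u+v\ge 0$ componentwise, and it then leads to the configuration $(s',u+v)$. A run is a sequence of transitions that can be fired one after another; it is over the word formed by the letters it reads. A configuration $(q,u)$ is accepting if there is $(q,u')\in F$ with $u\ge u'$ componentwise (coverability acceptance). The language $L(V)\subseteq\Sigma^*$ is the set of all words read by runs from $c_0$ to an accepting configuration. The VASS $V$ is deterministic if for every $q\in Q$ and $a\in\Sigma$ at most one transition over $a$ leaves $q$. A resolver for $V$ is a function which, given a history (a finite sequence of pairs of a configuration and the transition taken in it), a current configuration and a letter $a$, returns a transition of $V$ over $a$ that can be fired in the current configuration, whenever there is one. The VASS $V$ is history-deterministic if there is a resolver such that, for every $w\in L(V)$, the run over $w$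 from $c_0$ that follows the resolver letter by letter exists and is accepting. The following problem is undecidable: given a deterministic $2$-VASS $A$ and a history-deterministic $2$-VASS $B$ over the same finite alphabet (both given by finite descriptions that list their final configurations and their transitions), is $L(A)=L(B)$? That is, there is no algorithm which, on every input consisting of a deterministic $2$-VASS $A$ and a history-deterministic $2$-VASS $B$ over the same finite alphabet, halts and correctly answers whether $L(A)=L(B)$; nothing is required of the algorithm on other inputs. -/

import Mathlib

/-- A transition `(src, letter, eff, tgt)` of a `k`-dimensional VASS with alphabet `α` and
state set `Q`. -/
structure VASSTransition (k : ℕ) (α Q : Type) where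
  src : Q
  letter : α
  eff : Fin k → ℤ
  tgt : Q

/-- A configuration `q(u)`: a state together with the values of the `k` nonnegative counters. -/
abbrev VASSConfig (k : ℕ) (Q : Type) : Type := Q × (Fin k → ℕ)

/-- A history of a run: the configurations passed so far, each with the transition taken there,
in chronological order. -/
abbrev VASSHistory (k : ℕ) (α Q : Type) : Type :=
  List (VASSConfig k Q × VASSTransition k α Q)

/-- A `k`-dimensional vector addition system with states over the alphabet `α` with state set `Q`
(the theorem takes `α` and `Q` to be finite). -/
structure VASS (k : ℕ) (α Q : Type) where
  init : VASSConfig k Q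
  final : Finset (VASSConfig k Q)
  trans : Finset (VASSTransition k α Q)

namespace VASS

variable {k : ℕ} {α Q : Type}

/-- `t` is a transition of `V` that can be fired in `c`, and firing it leads to `c'`. The counters
of `c'` are natural numbers, so no counter drops below zero. -/
def Step (V : VASS k α Q) (c : VASSConfig k Q) (t : VASSTransition k α Q)
    (c' : VASSConfig k Q) : Prop :=
  t ∈ V.trans ∧ t.src = c.1 ∧ t.tgt = c'.1 ∧ ∀ i, (c'.2 i : ℤ) = (c.2 i : ℤ) + t.eff i

/-- `V.Run c ρ c'`: the sequence of transitions `ρ` is a run of `V` from `c` to `c'`. -/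
inductive Run (V : VASS k α Q) :
    VASSConfig k Q → List (VASSTransition k α Q) → VASSConfig k Q → Prop
  | nil (c : VASSConfig k Q) : Run V c [] c
  | cons {c c' c'' : VASSConfig k Q} {t : VASSTransition k α Q}
      {ρ : List (VASSTransition k α Q)} :
      V.Step c t c' → Run V c' ρ c'' → Run V c (t :: ρ) c''

/-- A configuration is accepting if it covers some final configuration. -/
def Accepting (V : VASS k α Q) (c : VASSConfig k Q) : Prop :=
  ∃ v : Fin k → ℕ, (c.1, v) ∈ V.final ∧ v ≤ c.2

/-- The coverability language: the words read by runs from the initial configuration to an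
accepting one. -/
def language (V : VASS k α Q) : Language α :=
  {w | ∃ (ρ : List (VASSTransition k α Q)) (c : VASSConfig k Q),
    V.Run V.init ρ c ∧ V.Accepting c ∧ ρ.map VASSTransition.letter = w}

/-- At most one transition leaves each state over each letter. -/
def IsDeterministic (V : VASS k α Q) : Prop :=
  ∀ t ∈ V.trans, ∀ t' ∈ V.trans, t.src = t'.src → t.letter = t'.letter → t = t'

/-- `r` is a resolver: given a history, a current configuration and a next letter, it returns a
transition over this letter which can be fired from the current configuration. The value `none`
is allowed only where there is no such transition. -/
def IsResolver (V : VASS k α Q)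
    (r : VASSHistory k α Q → VASSConfig k Q → α → Option (VASSTransition k α Q)) : Prop :=
  ∀ h c a,
    (∀ t, r h c a = some t → t.letter = a ∧ ∃ c', V.Step c t c') ∧
    (r h c a = none → ¬ ∃ t c', t.letter = a ∧ V.Step c t c')

/-- `V.ResolvedRun r w h c`: the run over `w` from the initial configuration given by `r` exists,
its history is `h`, and it ends in `c`. -/
inductive ResolvedRun (V : VASS k α Q)
    (r : VASSHistory k α Q → VASSConfig k Q → α → Option (VASSTransition k α Q)) :
    List α → VASSHistory k α Q → VASSConfig k Q → Prop
  | nil : ResolvedRun V r [] [] V.init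
  | snoc {w : List α} {h : VASSHistory k α Q} {c c' : VASSConfig k Q} {a : α}
      {t : VASSTransition k α Q} :
      ResolvedRun V r w h c → r h c a = some t → V.Step c t c' →
      ResolvedRun V r (w ++ [a]) (h ++ [(c, t)]) c'

/-- Some resolver gives an accepting run over every word of the language. -/
def IsHistoryDeterministic (V : VASS k α Q) : Prop :=
  ∃ r : VASSHistory k α Q → VASSConfig k Q → α → Option (VASSTransition k α Q),
    V.IsResolver r ∧ ∀ w ∈ V.language, ∃ h c, V.ResolvedRun r w h c ∧ V.Accepting c

end VASS

/-- The finite descriptions of `k`-VASSs that are given to an algorithm: the number of letters,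
the number of states, the initial configuration, a list of the final configurations and a list of
the transitions. Letters and states are written as natural numbers. -/
abbrev VASSCode (k : ℕ) : Type :=
  ℕ × ℕ × (ℕ × (Fin k → ℕ)) × List (ℕ × (Fin k → ℕ)) × List (ℕ × ℕ × (Fin k → ℤ) × ℕ)

/-- `c` is a description of the VASS `V` with `m` letters and `n` states: its two lists enumerate,
in any order, exactly the final configurations and the transitions of `V`. -/
def VASS.IsDescribedBy {k m n : ℕ} (V : VASS k (Fin m) (Fin n)) (c : VASSCode k) : Prop :=
  c.1 = m ∧ c.2.1 = n ∧ c.2.2.1 = ((V.init.1 : ℕ), V.init.2) ∧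
  (∀ x, x ∈ c.2.2.2.1 ↔ ∃ f ∈ V.final, x = ((f.1 : ℕ), f.2)) ∧
  (∀ x, x ∈ c.2.2.2.2 ↔
    ∃ t ∈ V.trans, x = ((t.src : ℕ), (t.letter : ℕ), t.eff, (t.tgt : ℕ)))

/-! The proof reduces the complement of the halting problem to the question. Halting of a program is
encoded as follows: there is a fixed regular language `M.accepts` of two-counter instruction
sequences (with zero tests) such that program number `n` halts iff some word of it executes exactly
from the counters `(p ^ n, 0)`.

The deterministic VASS `A` runs the DFA and performs the increments and decrements, but treats zero
tests as no-ops. The VASS `B` does the same and also looks for a wrong test: when a counter tested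
for zero is positive, `B` may prove this by decrementing it, and the next transition repays the
decrement. `B` accepts only after such a proof. Hence `L(B)` is `L(A)` without the words that
execute exactly, and `L(A) = L(B)` iff the program does not halt (`weakVASS_language_eq_iff`). `B`
is history-deterministic: exposing the first wrong test at once costs nothing, since the true
counter values evolve the same way afterwards (`exists_resolvedRun`).

The regular language comes from Minsky's simulation (`Prog.exists_regular_language`). Counter
programs are regular expressions over instructions. They compute all primitive recursive functions,
can guess a halting time, and are compiled to two counters by storing counter values as exponents of
distinct primes. Only the initial configurations depend on `n`, so the reduction is clearly
computable. -/

open scoped Computability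

/-! ### Closure of regular languages under concatenation and star -/

namespace Language

variable {α : Type*}

theorem mem_sSup {S : Set (Language α)} {x : List α} : x ∈ sSup S ↔ ∃ L ∈ S, x ∈ L :=
  Set.mem_sUnion

/-- The word `x` ends either inside the first factor or past it. The quotient is thus determined by
one quotient of `L` and a set of quotients of `M`, which leaves finitely many possibilities when
both languages are regular. -/
theorem leftQuotient_mul (L M : Language α) (x : List α) :
    (L * M).leftQuotient x = L.leftQuotient x * M +
      sSup {N | ∃ u ∈ L, ∃ v, x = u ++ v ∧ N = M.leftQuotient v} := by
  ext y
  rw [mem_add, mem_leftQuotient, mem_mul, mem_mul, mem_sSup]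
  constructor
  · rintro ⟨a, ha, b, hb, h⟩
    rcases List.append_eq_append_iff.1 h with ⟨c, rfl, rfl⟩ | ⟨c, rfl, rfl⟩
    · exact Or.inr ⟨_, ⟨a, ha, c, rfl, rfl⟩, hb⟩
    · exact Or.inl ⟨c, ha, b, hb, rfl⟩
  · rintro (⟨a, ha, b, hb, rfl⟩ | ⟨_, ⟨u, hu, v, rfl, rfl⟩, hy⟩)
    · exact ⟨x ++ a, ha, b, hb, by simp⟩
    · exact ⟨u, hu, v ++ y, hy, by simp⟩

theorem IsRegular.mul {L M : Language α} (hL : L.IsRegular) (hM : M.IsRegular) :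
    (L * M).IsRegular := by
  refine .of_finite_range_leftQuotient (Set.Finite.subset
    (Set.Finite.image2 (fun (A : Language α) (S : Set (Language α)) => A * M + sSup S)
      hL.finite_range_leftQuotient hM.finite_range_leftQuotient.powerset) ?_)
  rintro _ ⟨x, rfl⟩
  refine ⟨_, ⟨x, rfl⟩, _, ?_, (leftQuotient_mul L M x).symm⟩
  rintro _ ⟨u, -, v, -, rfl⟩
  exact ⟨v, rfl⟩

/-- The factor in which `x` ends is `v ++ y₁`. For empty `x` there might be no factor at all. -/
theorem exists_split_of_flatten_eq_append {L : Language α} (l : List (List α))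
    (hl : ∀ z ∈ l, z ∈ L) {x y : List α} (h : l.flatten = x ++ y) (hx : x ≠ []) :
    ∃ u ∈ L∗, ∃ v, x = u ++ v ∧ ∃ y₁ y₂, y = y₁ ++ y₂ ∧ v ++ y₁ ∈ L ∧ y₂ ∈ L∗ := by
  induction l generalizing x with
  | nil => simp_all
  | cons z l ih =>
    have hz := hl z (by simp)
    have hl' : ∀ z ∈ l, z ∈ L := fun w hw => hl w (by simp [hw])
    rw [List.flatten_cons] at h
    rcases List.append_eq_append_iff.1 h with ⟨c, rfl, h'⟩ | ⟨c, rfl, rfl⟩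
    · by_cases hc : c = []
      · subst hc
        exact ⟨[], nil_mem_kstar L, z, by simp, [], y, rfl, by simpa using hz,
          ⟨l, by simpa using h'.symm, hl'⟩⟩
      · obtain ⟨u, ⟨l', rfl, hu⟩, v, rfl, y₁, y₂, rfl, h₁, h₂⟩ := ih hl' h' hc
        refine ⟨z ++ l'.flatten, ⟨z :: l', by simp, ?_⟩, v, by simp, y₁, y₂, rfl, h₁, h₂⟩
        simpa using ⟨hz, hu⟩
    · exact ⟨[], nil_mem_kstar L, x, by simp, c, _, rfl, hz, ⟨l, rfl, hl'⟩⟩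

theorem leftQuotient_kstar (L : Language α) {x : List α} (hx : x ≠ []) :
    (L∗).leftQuotient x =
      sSup {N | ∃ u ∈ L∗, ∃ v, x = u ++ v ∧ N = L.leftQuotient v} * L∗ := by
  ext y
  simp only [mem_leftQuotient, mem_mul, mem_sSup]
  constructor
  · rintro ⟨l, h, hl⟩
    obtain ⟨u, hu, v, rfl, y₁, y₂, rfl, h₁, h₂⟩ :=
      exists_split_of_flatten_eq_append l hl h.symm hx
    exact ⟨y₁, ⟨_, ⟨u, hu, v, rfl, rfl⟩, h₁⟩, y₂, h₂, rfl⟩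
  · rintro ⟨y₁, ⟨_, ⟨u, ⟨l, rfl, hl⟩, v, rfl, rfl⟩, h₁⟩, _, ⟨l', rfl, hl'⟩, rfl⟩
    refine ⟨l ++ [v ++ y₁] ++ l', by simp, ?_⟩
    simp only [List.mem_append, List.mem_singleton]
    rintro z ((hz | rfl) | hz)
    exacts [hl z hz, h₁, hl' z hz]

theorem IsRegular.kstar {L : Language α} (hL : L.IsRegular) : (L∗).IsRegular := by
  -- The inserted `L∗` is the quotient by the empty word, which the formula does not cover.
  refine .of_finite_range_leftQuotient (Set.Finite.subset (Set.Finite.insert L∗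
    (Set.Finite.image (fun S : Set (Language α) => sSup S * L∗)
      hL.finite_range_leftQuotient.powerset)) ?_)
  rintro _ ⟨x, rfl⟩
  by_cases hx : x = []
  · exact Or.inl (by simp [hx])
  · refine Or.inr ⟨_, ?_, (leftQuotient_kstar L hx).symm⟩
    rintro _ ⟨u, -, v, -, rfl⟩
    exact ⟨v, rfl⟩

theorem isRegular_singleton (w : List α) : IsRegular ({w} : Set (List α)) := by
  refine .of_finite_range_leftQuotient (Set.Finite.subset
    (Set.Finite.image (fun S : Set (List α) => S)
      (Set.Finite.powerset (List.finite_toSet w.tails))) ?_)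
  rintro _ ⟨x, rfl⟩
  refine ⟨_, ?_, rfl⟩
  rintro y (hy : x ++ y = w)
  simpa using ⟨x, hy⟩

end Language

/-! ### Counter instructions and their execution -/

/-- The instructions of a counter machine with counters `ι`: decrement (`-1`), test for zero (`0`)
or increment (`1`) one counter. -/
abbrev Instr (ι : Type*) := SignType × ι

namespace Instr

variable {ι κ : Type*} [DecidableEq ι] [DecidableEq κ]

/-- The effect of an instruction on the counters. -/
def eff (a : Instr ι) : ι → ℤ := Pi.single a.2 (a.1 : ℤ)

/-- The counters change by the effect of the instruction; zero tests are not checked. -/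
def Weak (a : Instr ι) (s t : ι → ℕ) : Prop := ∀ i, (t i : ℤ) = s i + a.eff i

/-- The exact semantics of an instruction. -/
def Rel (a : Instr ι) (s t : ι → ℕ) : Prop := a.Weak s t ∧ (a.1 = 0 → s a.2 = 0)

theorem rel_inc {i : ι} {s t : ι → ℕ} :
    Rel (1, i) s t ↔ t = Function.update s i (s i + 1) := by
  simp only [Rel, Weak, eff, one_ne_zero, false_imp_iff, and_true, funext_iff]
  refine forall_congr' fun j => ?_
  by_cases h : j = i
  · subst h; simp; omega
  · simp [h]

theorem rel_zero {i : ι} {s t : ι → ℕ} : Rel (0, i) s t ↔ t = s ∧ s i = 0 := by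
  simp [Rel, Weak, eff, funext_iff]

theorem rel_dec {i : ι} {s t : ι → ℕ} :
    Rel (-1, i) s t ↔ s i ≠ 0 ∧ t = Function.update s i (s i - 1) := by
  have h0 : (-1 : SignType) ≠ 0 := by decide
  simp only [Rel, Weak, eff, h0, false_imp_iff, and_true, funext_iff]
  constructor
  · intro h
    have hi := h i
    simp only [Pi.single_eq_same, SignType.coe_neg_one] at hi
    refine ⟨by omega, fun j => ?_⟩
    by_cases hj : j = i
    · subst hj; simp; omega
    · simpa [hj] using h j
  · rintro ⟨hi, h⟩ j
    by_cases hj : j = i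
    · subst hj; simp [h]; omega
    · simp [h, hj]

/-- Renaming of counters. -/
def map (σ : ι → κ) (a : Instr ι) : Instr κ := (a.1, σ a.2)

theorem rel_map {σ : ι → κ} (hσ : σ.Injective) (a : Instr ι) {s t : κ → ℕ} :
    (a.map σ).Rel s t ↔ a.Rel (s ∘ σ) (t ∘ σ) ∧ ∀ j ∉ Set.range σ, t j = s j := by
  simp only [Rel, Weak, eff, map, Function.comp]
  constructor
  · rintro ⟨h, h0⟩
    refine ⟨⟨fun i => ?_, h0⟩, fun j hj => ?_⟩
    · rw [h]; simp [Pi.single_apply, hσ.eq_iff]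
    · have := h j
      rw [Pi.single_eq_of_ne (by rintro rfl; exact hj ⟨_, rfl⟩)] at this
      omega
  · rintro ⟨⟨h, h0⟩, h'⟩
    refine ⟨fun j => ?_, h0⟩
    by_cases hj : j ∈ Set.range σ
    · obtain ⟨i, rfl⟩ := hj
      rw [h]; simp [Pi.single_apply, hσ.eq_iff]
    · rw [h' j hj, Pi.single_eq_of_ne (by rintro rfl; exact hj ⟨_, rfl⟩)]
      simp

end Instr

/-- Execution of a word whose letters act as relations. -/
def Exec {α S : Type*} (R : α → S → S → Prop) : List α → S → S → Prop
  | [] => fun s t => t = s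
  | a :: w => fun s t => ∃ u, R a s u ∧ Exec R w u t

theorem exec_append {α S : Type*} {R : α → S → S → Prop} {w w' : List α} {s t : S} :
    Exec R (w ++ w') s t ↔ ∃ u, Exec R w s u ∧ Exec R w' u t := by
  induction w generalizing s with
  | nil => simp [Exec]
  | cons a w ih =>
    simp only [List.cons_append, Exec, ih]
    exact ⟨fun ⟨u, h, v, h1, h2⟩ => ⟨v, ⟨u, h, h1⟩, h2⟩, fun ⟨v, ⟨u, h, h1⟩, h2⟩ => ⟨u, h, v, h1, h2⟩⟩

theorem exec_concat {α S : Type*} {R : α → S → S → Prop} {w : List α} {a : α} {s t : S} :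
    Exec R (w ++ [a]) s t ↔ ∃ u, Exec R w s u ∧ R a u t := by
  simp [exec_append, Exec]

/-! ### Counter programs as regular expressions -/

/-- Nondeterministic counter programs: regular expressions over the instructions. -/
inductive Prog (ι : Type*) where
  | skip : Prog ι
  | atom : Instr ι → Prog ι
  | seq : Prog ι → Prog ι → Prog ι
  | alt : Prog ι → Prog ι → Prog ι
  | star : Prog ι → Prog ι

namespace Prog

variable {ι κ : Type*}

/-- The instruction sequences of a program. -/
def lang : Prog ι → Language (Instr ι)
  | skip => 1
  | atom a => ({[a]} : Set (List (Instr ι)))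
  | seq P Q => P.lang * Q.lang
  | alt P Q => P.lang + Q.lang
  | star P => P.lang∗

theorem isRegular_lang (P : Prog ι) : P.lang.IsRegular := by
  induction P with
  | skip => exact Language.isRegular_singleton []
  | atom a => exact Language.isRegular_singleton [a]
  | seq P Q hP hQ => exact hP.mul hQ
  | alt P Q hP hQ => exact hP.add hQ
  | star P hP => exact hP.kstar

variable [DecidableEq ι] [DecidableEq κ]

/-- The input-output relation of a program. -/
def Rel : Prog ι → (ι → ℕ) → (ι → ℕ) → Prop
  | skip => fun s t => t = s
  | atom a => a.Rel
  | seq P Q => fun s t => ∃ u, P.Rel s u ∧ Q.Rel u t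
  | alt P Q => fun s t => P.Rel s t ∨ Q.Rel s t
  | star P => Relation.ReflTransGen P.Rel

theorem rel_iff_exists_mem_lang (P : Prog ι) {s t : ι → ℕ} :
    P.Rel s t ↔ ∃ w ∈ P.lang, Exec Instr.Rel w s t := by
  induction P generalizing s t with
  | skip => simp [Rel, lang, Exec]
  | atom a =>
    refine ⟨fun h => ⟨[a], rfl, t, h, rfl⟩, ?_⟩
    rintro ⟨_, rfl, u, h, rfl⟩
    exact h
  | seq P Q hP hQ =>
    simp only [Rel, lang, hP, hQ, Language.mem_mul]
    constructor
    · rintro ⟨u, ⟨w, hw, h⟩, w', hw', h'⟩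
      exact ⟨_, ⟨w, hw, w', hw', rfl⟩, exec_append.2 ⟨u, h, h'⟩⟩
    · rintro ⟨_, ⟨w, hw, w', hw', rfl⟩, h⟩
      obtain ⟨u, h, h'⟩ := exec_append.1 h
      exact ⟨u, ⟨w, hw, h⟩, w', hw', h'⟩
  | alt P Q hP hQ => simp only [Rel, lang, hP, hQ, Language.mem_add, or_and_right, exists_or]
  | star P hP =>
    simp only [Rel, lang, Language.mem_kstar]
    constructor
    · intro h
      induction h with
      | refl => exact ⟨[], ⟨[], rfl, by simp⟩, rfl⟩
      | tail _ h ih =>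
        obtain ⟨_, ⟨l, rfl, hl⟩, h1⟩ := ih
        obtain ⟨w, hw, h2⟩ := hP.1 h
        refine ⟨_, ⟨l ++ [w], rfl, ?_⟩, ?_⟩
        · simp only [List.mem_append, List.mem_singleton]
          rintro z (hz | rfl)
          exacts [hl z hz, hw]
        · simpa [exec_append] using ⟨_, h1, h2⟩
    · rintro ⟨_, ⟨l, rfl, hl⟩, h⟩
      induction l generalizing s with
      | nil => rw [show t = s from h]
      | cons w l ih =>
        obtain ⟨u, h1, h2⟩ := exec_append.1 h
        exact .head (hP.2 ⟨w, hl w (by simp), h1⟩) (ih (fun z hz => hl z (by simp [hz])) h2)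

/-- Renaming of counters. -/
def map (σ : ι → κ) : Prog ι → Prog κ
  | skip => skip
  | atom a => atom (a.map σ)
  | seq P Q => seq (P.map σ) (Q.map σ)
  | alt P Q => alt (P.map σ) (Q.map σ)
  | star P => star (P.map σ)

/-- A frame rule: intermediate states of `P` lift along `σ` with the remaining counters fixed
(`key`), and a lifted state is determined by these two parts (`ext`). -/
theorem rel_map {σ : ι → κ} (hσ : σ.Injective) (P : Prog ι) {s t : κ → ℕ} :
    (P.map σ).Rel s t ↔ P.Rel (s ∘ σ) (t ∘ σ) ∧ ∀ j ∉ Set.range σ, t j = s j := by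
  classical
  have key : ∀ (s : κ → ℕ) (u : ι → ℕ), ∃ v : κ → ℕ, v ∘ σ = u ∧ ∀ j ∉ Set.range σ, v j = s j :=
    fun s u => ⟨Function.extend σ u s, funext fun i => hσ.extend_apply _ _ _,
      fun j hj => Function.extend_apply' _ _ _ hj⟩
  have ext : ∀ {s t : κ → ℕ}, s ∘ σ = t ∘ σ → (∀ j ∉ Set.range σ, s j = t j) → s = t := by
    intro s t h1 h2
    funext j
    by_cases hj : j ∈ Set.range σ
    · obtain ⟨i, rfl⟩ := hj; exact congrFun h1 i
    · exact h2 j hj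
  induction P generalizing s t with
  | skip => exact ⟨fun h => by simp_all [map, Rel], fun h => ext h.1 h.2⟩
  | atom a => exact Instr.rel_map hσ a
  | seq P Q hP hQ =>
    simp only [map, Rel, hP, hQ]
    constructor
    · rintro ⟨u, ⟨h1, h2⟩, h3, h4⟩
      exact ⟨⟨_, h1, h3⟩, fun j hj => (h4 j hj).trans (h2 j hj)⟩
    · rintro ⟨⟨u, h1, h2⟩, h3⟩
      obtain ⟨v, rfl, hv⟩ := key s u
      exact ⟨v, ⟨h1, hv⟩, h2, fun j hj => (h3 j hj).trans (hv j hj).symm⟩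
  | alt P Q hP hQ => simp only [map, Rel, hP, hQ, or_and_right]
  | star P hP =>
    simp only [map, Rel]
    constructor
    · intro h
      induction h with
      | refl => exact ⟨.refl, fun _ _ => rfl⟩
      | tail _ h ih =>
        have h := hP.1 h
        exact ⟨ih.1.tail h.1, fun j hj => (h.2 j hj).trans (ih.2 j hj)⟩
    · rintro ⟨h, h'⟩
      generalize hu : t ∘ σ = u at h
      induction h generalizing t with
      | refl => rw [ext hu h']
      | @tail b c _ h ih =>
        obtain ⟨v, hv, hv'⟩ := key s b
        subst hu
        exact (ih hv' hv).tail (hP.2 ⟨hv ▸ h, fun j hj => (h' j hj).trans (hv' j hj).symm⟩)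

end Prog

/-! ### Counter programs for primitive recursive functions -/

namespace Prog

variable {ι κ : Type*} [DecidableEq ι] [DecidableEq κ]

/-- Started in `s`, the program can end in `u` and nowhere else. -/
def Det (P : Prog ι) (s u : ι → ℕ) : Prop := ∀ t, P.Rel s t ↔ t = u

theorem det_skip (s : ι → ℕ) : Det skip s s := fun _ => Iff.rfl

theorem det_inc (i : ι) (s : ι → ℕ) :
    Det (atom (1, i)) s (Function.update s i (s i + 1)) := fun _ => Instr.rel_inc

theorem Det.seq {P Q : Prog ι} {s u v : ι → ℕ} (hP : Det P s u) (hQ : Det Q u v) :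
    Det (P.seq Q) s v := fun t => by
  simp only [Rel, hP _, exists_eq_left, hQ _]

theorem Det.map {σ : ι → κ} (hσ : σ.Injective) {P : Prog ι} {s t : κ → ℕ} {s' t' : ι → ℕ}
    (h : Det P s' t') (hs : s ∘ σ = s') (ht : t ∘ σ = t') (hj : ∀ j ∉ Set.range σ, t j = s j) :
    Det (P.map σ) s t := fun u => by
  subst hs ht
  rw [rel_map hσ, h]
  constructor
  · rintro ⟨h1, h2⟩
    funext j
    by_cases hr : j ∈ Set.range σ
    · obtain ⟨i, rfl⟩ := hr; exact congrFun h1 i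
    · rw [h2 j hr, hj j hr]
  · rintro rfl
    exact ⟨rfl, hj⟩

/-- Run `P` until the counter `i`, decremented before each round, is zero. -/
def loop (i : ι) (P : Prog ι) : Prog ι := seq (star (seq (atom (-1, i)) P)) (atom (0, i))

/-- `S k` is the state with `k` rounds left. The star may be left after any round, but the final
zero test blocks every exit except at `S 0`, where the decrement blocks another round. -/
theorem det_loop {i : ι} {P : Prog ι} (S : ℕ → ι → ℕ) (hS : ∀ k, S k i = k) (n : ℕ)
    (h : ∀ k < n, Det P (Function.update (S (k + 1)) i k) (S k)) :
    Det (loop i P) (S n) (S 0) := by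
  have hbody : ∀ k < n, ∀ t, (seq (atom (-1, i)) P).Rel (S (k + 1)) t ↔ t = S k := by
    intro k hk t
    simp only [Rel, Instr.rel_dec, hS, Nat.add_sub_cancel]
    constructor
    · rintro ⟨u, ⟨-, rfl⟩, ht⟩
      exact (h k hk t).1 ht
    · rintro rfl
      exact ⟨_, ⟨by omega, rfl⟩, (h k hk _).2 rfl⟩
  have hzero : ∀ t, ¬ (seq (atom (-1, i)) P).Rel (S 0) t := by
    rintro t ⟨u, hu, -⟩
    exact (Instr.rel_dec.1 hu).1 (hS 0)
  intro t
  constructor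
  · rintro ⟨u, hu, ht⟩
    obtain ⟨rfl, hi⟩ := Instr.rel_zero.1 ht
    have : ∃ k ≤ n, t = S k := by
      change Relation.ReflTransGen _ _ _ at hu
      clear ht hi
      induction hu with
      | refl => exact ⟨n, le_rfl, rfl⟩
      | tail _ h ih =>
        obtain ⟨k, hk, rfl⟩ := ih
        cases k with
        | zero => exact absurd h (hzero _)
        | succ k => exact ⟨k, by omega, (hbody k (by omega) _).1 h⟩
    obtain ⟨k, -, rfl⟩ := this
    rw [hS] at hi
    rw [hi]
  · rintro rfl
    refine ⟨S 0, ?_, Instr.rel_zero.2 ⟨rfl, hS 0⟩⟩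
    change Relation.ReflTransGen _ _ _
    clear hzero h
    induction n with
    | zero => exact .refl
    | succ n ih =>
      exact .head ((hbody n (by omega) _).2 rfl) (ih fun k hk => hbody k (by omega))

/-- Set the counter `i` to zero. -/
def clear (i : ι) : Prog ι := loop i skip

theorem det_clear (i : ι) (s : ι → ℕ) : Det (clear i) s (Function.update s i 0) := by
  have := det_loop (i := i) (P := skip) (fun k => Function.update s i k) (by simp) (s i)
    (fun k _ => by simpa using det_skip _)
  simpa [clear] using this

/-- Add the counter `i` to the counter `j` and set `i` to zero. -/
def move (i j : ι) : Prog ι := loop i (atom (1, j))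

theorem det_move {i j : ι} (hij : i ≠ j) (s : ι → ℕ) :
    Det (move i j) s (Function.update (Function.update s j (s j + s i)) i 0) := by
  have := det_loop (i := i) (P := atom (1, j))
    (fun k => Function.update (Function.update s j (s j + (s i - k))) i k) (by simp) (s i)
    (fun k hk => by
      refine cast (congrArg _ ?_) (det_inc j _)
      rw [Function.update_idem, Function.update_comm hij]
      simp [hij.symm]
      congr 2
      omega)
  simpa [move] using this

/-- Copy the counter `i` to the counter `j`, using the counter `k`. -/
def copy (i j k : ι) : Prog ι := seq (loop i (seq (atom (1, j)) (atom (1, k)))) (move k i)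

theorem det_copy {i j k : ι} (hij : i ≠ j) (hik : i ≠ k) (hjk : j ≠ k) (s : ι → ℕ) (hj : s j = 0)
    (hk : s k = 0) : Det (copy i j k) s (Function.update s j (s i)) := by
  have := det_loop (i := i) (P := seq (atom (1, j)) (atom (1, k)))
    -- What has left `i` has been added to both `j` and `k`; moving `k` back restores `i`.
    (fun n => Function.update (Function.update (Function.update s j (s i - n)) k (s i - n)) i n)
    (by simp) (s i) (fun n hn => by
      refine cast (congrArg _ ?_) ((det_inc j _).seq (det_inc k _))
      funext x
      simp only [Function.update_apply]
      split_ifs <;> simp_all <;> omega)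
  have h2 := det_move hik.symm (Function.update (Function.update (Function.update s j (s i)) k (s i)) i 0)
  have h1 : Function.update (Function.update (Function.update s j (s i - s i)) k (s i - s i)) i (s i)
      = s := by
    funext x
    simp only [Function.update_apply]
    split_ifs <;> simp_all
  rw [h1] at this
  refine cast (congrArg _ ?_) (this.seq h2)
  funext x
  simp only [Function.update_apply]
  grind

/-- `P` leaves its arguments unchanged and writes `f` of them to the first work counter. -/
def Computes {n : ℕ} (P : Prog (Fin n ⊕ ℕ)) (f : List.Vector ℕ n → ℕ) : Prop :=
  ∀ v, Det P (Sum.elim v.get 0) (Sum.elim v.get (Pi.single 0 (f v)))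

theorem computes_get {n : ℕ} (i : Fin n) :
    Computes (copy (.inl i) (.inr 0) (.inr 1)) fun v => v.get i := fun v => by
  refine cast (congrArg _ ?_) (det_copy (by simp) (by simp) (by simp) _ (by simp) (by simp))
  rw [Sum.update_elim_inr]
  rfl

theorem computes_succ :
    Computes (seq (copy (.inl 0) (.inr 0) (.inr 1)) (atom (1, .inr 0)))
      fun v : List.Vector ℕ 1 => v.head.succ := fun v => by
  refine cast (congrArg _ ?_) ((computes_get 0 v).seq (det_inc _ _))
  rw [Sum.update_elim_inr]
  congr 1
  funext j
  by_cases hj : j = 0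
  · subst hj; simp
  · simp [hj]

theorem exists_det_clear_lt {n : ℕ} (k : ℕ) : ∃ P : Prog (Fin n ⊕ ℕ), ∀ (v : Fin n → ℕ) (w : ℕ → ℕ),
    Det P (Sum.elim v w) (Sum.elim v fun j => if j < k then 0 else w j) := by
  induction k with
  | zero => exact ⟨skip, fun v w => by simpa using det_skip _⟩
  | succ k ih =>
    obtain ⟨P, hP⟩ := ih
    refine ⟨seq P (clear (.inr k)), fun v w => ?_⟩
    refine cast (congrArg _ ?_) ((hP v w).seq (det_clear _ _))
    rw [Sum.update_elim_inr]
    congr 1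
    funext j
    simp only [Function.update_apply]
    split_ifs <;> first | rfl | omega

/-- The program for `g k` is shifted by `k` work counters: its result lands in counter `k`, and all
the work counters that it sees are still zero. -/
theorem exists_det_compute_lt {m n : ℕ} (g : Fin n → List.Vector ℕ m → ℕ)
    (hg : ∀ i, ∃ P, Computes P (g i)) (k : ℕ) (hk : k ≤ n) :
    ∃ P : Prog (Fin m ⊕ ℕ), ∀ v : List.Vector ℕ m, Det P (Sum.elim v.get 0)
      (Sum.elim v.get fun j => if h : j < n ∧ j < k then g ⟨j, h.1⟩ v else 0) := by
  induction k with
  | zero => exact ⟨skip, fun v => cast (congrArg _ (by simp [← Pi.zero_def])) (det_skip _)⟩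
  | succ k ih =>
    obtain ⟨P, hP⟩ := ih (by omega)
    obtain ⟨Q, hQ⟩ := hg ⟨k, by omega⟩
    have hσ : (Sum.map id (k + ·) : Fin m ⊕ ℕ → Fin m ⊕ ℕ).Injective :=
      Sum.map_injective.2 ⟨Function.injective_id, add_right_injective k⟩
    refine ⟨seq P (Q.map (Sum.map id (k + ·))), fun v => (hP v).seq ((hQ v).map hσ ?_ ?_ ?_)⟩
    · funext x
      rcases x with x | x <;> simp
    · funext x
      rcases x with x | x
      · rfl
      · have hkn : k < n := hk
        by_cases hx : x = 0
        · subst hx; simp [hkn]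
        · simp [hx]
    · rintro (x | x) hx
      · rfl
      · have : x < k := by
          by_contra h
          exact hx ⟨.inr (x - k), by simp; omega⟩
        have h1 : x < n := by omega
        simp [h1, this, this.le]

theorem exists_computes_comp {m n : ℕ} {f : List.Vector ℕ n → ℕ} (g : Fin n → List.Vector ℕ m → ℕ)
    (hf : ∃ P, Computes P f) (hg : ∀ i, ∃ P, Computes P (g i)) :
    ∃ P, Computes P fun v => f (List.Vector.ofFn fun i => g i v) := by
  obtain ⟨P, hP⟩ := exists_det_compute_lt g hg n le_rfl
  obtain ⟨Q, hQ⟩ := hf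
  obtain ⟨C, hC⟩ := exists_det_clear_lt (n := m) n
  -- The values of the `g i` serve as arguments of `f`. The offset `n + 1` rather than `n` keeps the
  -- result counter of `f` distinct from counter `0` even if `n = 0`, as the final `move` needs.
  let σ : Fin n ⊕ ℕ → Fin m ⊕ ℕ := Sum.elim (fun i => .inr i) (fun j => .inr (n + 1 + j))
  have hσ : σ.Injective := by
    rintro (x | x) (y | y) h <;> simp [σ] at h ⊢
    · exact Fin.ext h
    · omega
    · omega
    · exact h
  refine ⟨seq P (seq (Q.map σ) (seq C (move (.inr (n + 1)) (.inr 0)))), fun v => ?_⟩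
  have h2 : Det (Q.map σ)
      (Sum.elim v.get fun j => if h : j < n ∧ j < n then g ⟨j, h.1⟩ v else 0)
      (Sum.elim v.get fun j => if h : j < n then g ⟨j, h⟩ v else
        if j = n + 1 then f (List.Vector.ofFn fun i => g i v) else 0) := by
    refine (hQ (List.Vector.ofFn fun i => g i v)).map hσ ?_ ?_ ?_
    · funext x
      rcases x with x | x
      · simp [σ]
      · simp [σ]; omega
    · funext x
      rcases x with x | x
      · simp [σ]
      · have : ¬ (n + 1 + x < n) := by omega
        by_cases hx : x = 0
        · subst hx; simp [σ]
        · simp [σ, hx, this]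
    · rintro (x | x) hx
      · rfl
      · have : x ≠ n + 1 := fun h => hx ⟨.inr 0, by simp [σ, h]⟩
        simp [this]
  refine cast (congrArg _ ?_) ((hP v).seq (h2.seq ((hC _ _).seq (det_move (by simp) _))))
  rw [Sum.update_elim_inr, Sum.update_elim_inr]
  congr 1
  funext j
  simp only [Function.update_apply, Pi.single_apply, Sum.elim_inr]
  by_cases hj : j = 0
  · subst hj; simp; intro _ _; omega
  · by_cases hj' : j = n + 1
    · simp [hj']
    · simp [hj, hj']
      intro _ _; omega

/-- The work counters hold the entries of a list, followed by zeros. -/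
def regs (l : List ℕ) : ℕ → ℕ := fun j => l.getD j 0

theorem update_regs {l : List ℕ} {j x : ℕ} (hj : j < l.length) :
    Function.update (regs l) j x = regs (l.set j x) := by
  funext i
  simp only [regs, Function.update_apply, List.getD_eq_getElem?_getD, List.getElem?_set]
  by_cases h : i = j
  · subst h; simp [hj]
  · simp [h, Ne.symm h]

theorem exists_computes_prec {n : ℕ} {f : List.Vector ℕ n → ℕ} {g : List.Vector ℕ (n + 2) → ℕ}
    (hf : ∃ P, Computes P f) (hg : ∃ P, Computes P g) :
    ∃ P, Computes P fun v : List.Vector ℕ (n + 1) =>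
      v.head.rec (f v.tail) fun y IH => g (y ::ᵥ IH ::ᵥ v.tail) := by
  obtain ⟨P, hP⟩ := hf
  obtain ⟨Q, hQ⟩ := hg
  -- Work counters: `0` for the final result, `1` for the rounds left, `2` for the recursion index,
  -- `3` for the current value, and from `4` on for `Q`. The shift by `3` puts the result of `P`
  -- where the first current value belongs.
  let σ : Fin n ⊕ ℕ → Fin (n + 1) ⊕ ℕ := Sum.map Fin.succ (3 + ·)
  have hσ : σ.Injective :=
    Sum.map_injective.2 ⟨Fin.succ_injective n, add_right_injective 3⟩
  let τ : Fin (n + 2) ⊕ ℕ → Fin (n + 1) ⊕ ℕ :=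
    Sum.elim (Fin.cons (.inr 2) (Fin.cons (.inr 3) fun i => .inl i.succ)) (fun j => .inr (4 + j))
  have hτ : τ.Injective := by
    rintro (x | x) (y | y) h
    · induction x using Fin.cases with
      | zero =>
        induction y using Fin.cases with
        | zero => rfl
        | succ y => induction y using Fin.cases <;> simp [τ] at h
      | succ x =>
        induction y using Fin.cases with
        | zero => induction x using Fin.cases <;> simp [τ] at h
        | succ y =>
          induction x using Fin.cases <;> induction y using Fin.cases <;> simp [τ] at h ⊢
          exact h
    · induction x using Fin.cases with
      | zero => simp [τ] at h; omega
      | succ x => induction x using Fin.cases <;> simp [τ] at h; omega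
    · induction y using Fin.cases with
      | zero => simp [τ] at h; omega
      | succ x => induction x using Fin.cases <;> simp [τ] at h; omega
    · simpa [τ] using h
  let body : Prog (Fin (n + 1) ⊕ ℕ) :=
    seq (Q.map τ) (seq (clear (.inr 3)) (seq (move (.inr 4) (.inr 3)) (atom (1, .inr 2))))
  refine ⟨seq (copy (.inl 0) (.inr 1) (.inr 2)) (seq (P.map σ) (seq (loop (.inr 1) body)
    (seq (clear (.inr 2)) (move (.inr 3) (.inr 0))))), fun v => ?_⟩
  let F : ℕ → ℕ := fun m => m.rec (f v.tail) fun y IH => g (y ::ᵥ IH ::ᵥ v.tail)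
  let S : ℕ → Fin (n + 1) ⊕ ℕ → ℕ := fun k =>
    Sum.elim v.get (regs [0, k, v.head - k, F (v.head - k), 0])
  have hbody : ∀ k c a, Det body (Sum.elim v.get (regs [0, k, c, a, 0]))
      (Sum.elim v.get (regs [0, k, c + 1, g (c ::ᵥ a ::ᵥ v.tail), 0])) := by
    intro k c a
    have h1 : Det (Q.map τ) (Sum.elim v.get (regs [0, k, c, a, 0]))
        (Sum.elim v.get (regs [0, k, c, a, g (c ::ᵥ a ::ᵥ v.tail)])) := by
      refine (hQ (c ::ᵥ a ::ᵥ v.tail)).map hτ ?_ ?_ ?_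
      · funext x
        rcases x with x | x
        · induction x using Fin.cases with
          | zero => simp [τ, regs]
          | succ x =>
            induction x using Fin.cases with
            | zero => simp [τ, regs]; rfl
            | succ x => simp [τ]
        · rcases x with _ | x
          · simp [τ, regs]
          · have : 4 + (x + 1) = x + 5 := by omega
            simp [τ, regs, this]
      · funext x
        rcases x with x | x
        · induction x using Fin.cases with
          | zero => simp [τ, regs]
          | succ x =>
            induction x using Fin.cases with
            | zero => simp [τ, regs]; rfl
            | succ x => simp [τ]
        · rcases x with _ | x
          · simp [τ, regs]
          · have : 4 + (x + 1) = x + 5 := by omega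
            simp [τ, regs, this]
      · rintro (x | x) hx
        · rfl
        · rcases x with _ | _ | _ | _ | _ | x <;> simp [regs]
          exact absurd ⟨.inr 0, rfl⟩ hx
    refine cast (congrArg _ ?_)
      (h1.seq ((det_clear _ _).seq ((det_move (by simp) _).seq (det_inc _ _))))
    simp [Sum.update_elim_inr, update_regs]
    simp [regs]
  have h1 : Det (copy (.inl 0) (.inr 1) (.inr 2)) (Sum.elim v.get 0)
      (Sum.elim v.get (regs [0, v.head, 0, 0, 0])) := by
    refine cast (congrArg _ ?_) (det_copy (by simp) (by simp) (by simp) _ (by simp) (by simp))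
    rw [Sum.update_elim_inr]
    congr 1
    funext x
    rcases x with _ | _ | _ | _ | _ | x <;> simp [regs]
  have h2 : Det (P.map σ) (Sum.elim v.get (regs [0, v.head, 0, 0, 0]))
      (S v.head) := by
    refine (hP v.tail).map hσ ?_ ?_ ?_
    · funext x
      rcases x with x | x
      · simp [σ]
      · rcases x with _ | _ | x
        · simp [σ, regs]
        · simp [σ, regs]
        · have : 3 + (x + 1 + 1) = x + 5 := by omega
          simp [σ, regs, this]
    · funext x
      rcases x with x | x
      · simp [σ, S]
      · rcases x with _ | _ | x
        · simp [σ, regs, S, F]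
        · simp [σ, regs, S]
        · have : 3 + (x + 1 + 1) = x + 5 := by omega
          simp [σ, regs, this, S]
    · rintro (x | x) hx
      · rfl
      · rcases x with _ | _ | _ | _ | _ | x <;> simp [regs, S]
        exact absurd ⟨.inr 0, rfl⟩ hx
  have h3 : Det (loop (.inr 1) body) (S v.head) (S 0) := by
    refine det_loop S (fun k => by simp [S, regs]) _ fun k hk => ?_
    obtain ⟨d, hd⟩ : ∃ d, v.head = k + 1 + d := ⟨_, (Nat.add_sub_cancel' hk).symm⟩
    have e1 : v.head - (k + 1) = d := by omega
    have e2 : v.head - k = d + 1 := by omega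
    simp only [S, Sum.update_elim_inr, e1, e2]
    rw [update_regs (by simp)]
    exact hbody k d (F d)
  refine cast (congrArg _ ?_)
    (h1.seq (h2.seq (h3.seq ((det_clear _ _).seq (det_move (by simp) _)))))
  simp only [S, Sum.update_elim_inr]
  congr 1
  funext x
  rcases x with _ | _ | _ | _ | _ | x <;> simp [regs, F]

theorem exists_computes_of_primrec' {n : ℕ} {f : List.Vector ℕ n → ℕ} (hf : Nat.Primrec' f) :
    ∃ P, Computes P f := by
  induction hf with
  | zero => exact ⟨skip, fun v => by simpa using det_skip _⟩
  | succ => exact ⟨_, computes_succ⟩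
  | get i => exact ⟨_, computes_get i⟩
  | comp g _ _ hf hg => exact exists_computes_comp g hf hg
  | prec _ _ hf hg => exact exists_computes_prec hf hg

end Prog

/-! ### Simulation of counter programs by two counters -/

namespace Prog

/-- Run `P` `k` times. -/
def rep {ι : Type*} (P : Prog ι) : ℕ → Prog ι
  | 0 => skip
  | k + 1 => seq P (P.rep k)

theorem update_vec_zero (a b x : ℕ) : Function.update ![a, b] 0 x = ![x, b] := by
  funext i; fin_cases i <;> rfl

theorem update_vec_one (a b x : ℕ) : Function.update ![a, b] 1 x = ![a, x] := by
  funext i; fin_cases i <;> rfl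

theorem det_rep_inc_zero (a b k : ℕ) : Det (rep (atom (1, 0)) k) ![a, b] ![a + k, b] := by
  induction k generalizing a with
  | zero => exact det_skip _
  | succ k ih =>
    refine cast (congrArg _ ?_) ((det_inc 0 ![a, b]).seq (update_vec_zero a b _ ▸ ih (a + 1)))
    rw [add_right_comm, add_assoc]

theorem det_rep_inc_one (a b k : ℕ) : Det (rep (atom (1, 1)) k) ![a, b] ![a, b + k] := by
  induction k generalizing b with
  | zero => exact det_skip _
  | succ k ih =>
    refine cast (congrArg _ ?_) ((det_inc 1 ![a, b]).seq (update_vec_one a b _ ▸ ih (b + 1)))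
    rw [add_right_comm, add_assoc]

theorem rel_rep_dec_zero {a b k : ℕ} {t : Fin 2 → ℕ} :
    (rep (atom (-1, 0)) k).Rel ![a, b] t ↔ k ≤ a ∧ t = ![a - k, b] := by
  induction k generalizing a with
  | zero => simp [rep, Rel]
  | succ k ih =>
    simp only [rep, Rel, Instr.rel_dec, update_vec_zero]
    constructor
    · rintro ⟨u, ⟨h, rfl⟩, h'⟩
      obtain ⟨h1, rfl⟩ := ih.1 h'
      simp only [Matrix.cons_val_zero] at h h1 ⊢
      refine ⟨by omega, ?_⟩
      congr 1; omega
    · rintro ⟨h, rfl⟩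
      refine ⟨_, ⟨by simp; omega, rfl⟩, ih.2 ?_⟩
      simp only [Matrix.cons_val_zero]
      refine ⟨by omega, ?_⟩
      congr 1; omega

theorem det_move_one_zero (a b : ℕ) : Det (move (1 : Fin 2) 0) ![a, b] ![a + b, 0] := by
  simpa [update_vec_zero, update_vec_one] using det_move (i := (1 : Fin 2)) (j := 0) (by simp) ![a, b]

/-- Multiply the first counter by `p`. -/
def mulConst (p : ℕ) : Prog (Fin 2) := seq (loop 0 (rep (atom (1, 1)) p)) (move 1 0)

theorem det_mulConst (p N : ℕ) : Det (mulConst p) ![N, 0] ![p * N, 0] := by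
  have := det_loop (i := (0 : Fin 2)) (P := rep (atom (1, 1)) p)
    (fun k => ![k, p * (N - k)]) (by simp) N (fun k hk => by
      rw [update_vec_zero]
      refine cast (congrArg _ ?_) (det_rep_inc_one k _ p)
      obtain ⟨d, rfl⟩ : ∃ d, N = k + 1 + d := ⟨_, (Nat.add_sub_cancel' hk).symm⟩
      rw [show k + 1 + d - (k + 1) = d by omega, show k + 1 + d - k = d + 1 by omega]
      rfl)
  simpa [mulConst] using this.seq (det_move_one_zero _ _)

/-- Repeatedly subtract `p` from the first counter and add `q` to the second one. -/
def transfer (p q : ℕ) : Prog (Fin 2) :=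
  star (seq (rep (atom (-1, 0)) p) (rep (atom (1, 1)) q))

/-- The number `k` of rounds is a guess; the tests that follow a transfer reject the wrong guesses.
-/
theorem rel_transfer {p q N : ℕ} {t : Fin 2 → ℕ} :
    (transfer p q).Rel ![N, 0] t ↔ ∃ k, p * k ≤ N ∧ t = ![N - p * k, q * k] := by
  have hstep : ∀ a b t, (seq (rep (atom (-1, 0)) p) (rep (atom (1, 1)) q)).Rel ![a, b] t ↔
      p ≤ a ∧ t = ![a - p, b + q] := by
    intro a b t
    simp only [Rel, rel_rep_dec_zero]
    constructor
    · rintro ⟨u, ⟨h, rfl⟩, h'⟩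
      exact ⟨h, (det_rep_inc_one _ _ _ _).1 h'⟩
    · rintro ⟨h, rfl⟩
      exact ⟨_, ⟨h, rfl⟩, (det_rep_inc_one _ _ _ _).2 rfl⟩
  constructor
  · intro h
    change Relation.ReflTransGen _ _ _ at h
    induction h with
    | refl => exact ⟨0, by simp⟩
    | tail _ h ih =>
      obtain ⟨k, hk, rfl⟩ := ih
      obtain ⟨h1, rfl⟩ := (hstep _ _ _).1 h
      refine ⟨k + 1, by rw [mul_add]; omega, ?_⟩
      rw [mul_add, mul_add, mul_one, mul_one, Nat.sub_sub]
  · rintro ⟨k, hk, rfl⟩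
    change Relation.ReflTransGen _ _ _
    induction k with
    | zero => exact .refl
    | succ k ih =>
      rw [mul_add, mul_one] at hk
      refine (ih (by omega)).tail ((hstep _ _ _).2 ⟨by omega, ?_⟩)
      rw [mul_add, mul_add, mul_one, mul_one, Nat.sub_sub]

/-- Divide the first counter by `p`, if it is divisible by `p`. -/
def divConst (p : ℕ) : Prog (Fin 2) := seq (transfer p 1) (seq (atom (0, 0)) (move 1 0))

theorem rel_divConst {p N : ℕ} {t : Fin 2 → ℕ} :
    (divConst p).Rel ![N, 0] t ↔ ∃ M, N = p * M ∧ t = ![M, 0] := by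
  constructor
  · rintro ⟨u, hu, v, hv, ht⟩
    obtain ⟨k, hk, rfl⟩ := rel_transfer.1 hu
    obtain ⟨rfl, h0⟩ := Instr.rel_zero.1 hv
    have h0 : N - p * k = 0 := h0
    exact ⟨k, by omega, by simpa [h0] using (det_move_one_zero _ _ _).1 ht⟩
  · rintro ⟨M, rfl, rfl⟩
    exact ⟨_, rel_transfer.2 ⟨M, le_rfl, rfl⟩, _, Instr.rel_zero.2 ⟨rfl, by simp⟩,
      (det_move_one_zero _ _ _).2 (by simp)⟩

/-- Test whether the first counter is between `1` and `k + 1`. -/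
def testRange : ℕ → Prog (Fin 2)
  | 0 => seq (rep (atom (-1, 0)) 1) (seq (atom (0, 0)) (rep (atom (1, 0)) 1))
  | k + 1 => alt (testRange k)
      (seq (rep (atom (-1, 0)) (k + 2)) (seq (atom (0, 0)) (rep (atom (1, 0)) (k + 2))))

theorem rel_testRange {k a b : ℕ} {t : Fin 2 → ℕ} :
    (testRange k).Rel ![a, b] t ↔ (1 ≤ a ∧ a ≤ k + 1) ∧ t = ![a, b] := by
  have h : ∀ r, (seq (rep (atom (-1, 0)) r) (seq (atom (0, 0)) (rep (atom (1, 0)) r))).Rel ![a, b] t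
      ↔ a = r ∧ t = ![a, b] := by
    intro r
    constructor
    · rintro ⟨u, hu, v, hv, ht⟩
      obtain ⟨h, rfl⟩ := rel_rep_dec_zero.1 hu
      obtain ⟨rfl, h0⟩ := Instr.rel_zero.1 hv
      have h0 : a - r = 0 := h0
      obtain rfl : a = r := by omega
      exact ⟨rfl, by simpa using (det_rep_inc_zero _ _ _ _).1 ht⟩
    · rintro ⟨rfl, rfl⟩
      exact ⟨_, rel_rep_dec_zero.2 ⟨le_rfl, rfl⟩, _, Instr.rel_zero.2 ⟨rfl, by simp⟩,
        (det_rep_inc_zero _ _ _ _).2 (by simp)⟩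
  induction k with
  | zero =>
    rw [testRange, h]
    exact and_congr_left fun _ => by omega
  | succ k ih =>
    rw [testRange]
    refine (or_congr ih (h _)).trans ?_
    rw [← or_and_right]
    exact and_congr_left fun _ => by omega

/-- Test that the first counter is not divisible by `p`. -/
def testNotDvd (p : ℕ) : Prog (Fin 2) :=
  seq (transfer p p) (seq (testRange (p - 2)) (move 1 0))

/-- After the transfer the first counter must lie between `1` and `p - 1 = (p - 2) + 1`, so it holds
a nonzero remainder of `N`. The second counter keeps what was subtracted, and `move` gives it back.
-/
theorem rel_testNotDvd {p N : ℕ} (hp : 2 ≤ p) {t : Fin 2 → ℕ} :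
    (testNotDvd p).Rel ![N, 0] t ↔ ¬ p ∣ N ∧ t = ![N, 0] := by
  constructor
  · rintro ⟨u, hu, v, hv, ht⟩
    obtain ⟨k, hk, rfl⟩ := rel_transfer.1 hu
    obtain ⟨h, rfl⟩ := rel_testRange.1 hv
    refine ⟨fun hd => ?_, ?_⟩
    · exact Nat.not_dvd_of_pos_of_lt (by omega) (by omega : N - p * k < p)
        (Nat.dvd_sub hd (dvd_mul_right p k))
    · simpa [Nat.sub_add_cancel hk] using (det_move_one_zero _ _ _).1 ht
  · rintro ⟨hd, rfl⟩
    have h1 := Nat.div_add_mod N p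
    have h2 := Nat.mod_lt N (by omega : p > 0)
    have h3 : N % p ≠ 0 := fun h => hd (Nat.dvd_of_mod_eq_zero h)
    refine ⟨_, rel_transfer.2 ⟨N / p, by omega, rfl⟩, _, rel_testRange.2 ⟨by omega, rfl⟩,
      (det_move_one_zero _ _ _).2 ?_⟩
    rw [Nat.sub_add_cancel (by omega)]

/-- The two-counter program which simulates a program, the value of the counter `i` being the
exponent of `p i` in the first counter. -/
def compile {ι : Type*} (p : ι → ℕ) : Prog ι → Prog (Fin 2)
  | skip => skip
  | atom (.pos, i) => mulConst (p i)
  | atom (.neg, i) => divConst (p i)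
  | atom (.zero, i) => testNotDvd (p i)
  | seq P Q => seq (P.compile p) (Q.compile p)
  | alt P Q => alt (P.compile p) (Q.compile p)
  | star P => star (P.compile p)

/-- The counter values encoded in a number. -/
def decode {ι : Type*} (p : ι → ℕ) (N : ℕ) (i : ι) : ℕ := N.factorization (p i)

theorem dvd_iff_decode_ne_zero {ι : Type*} {p : ι → ℕ} (hp : ∀ i, (p i).Prime) (i : ι) {N : ℕ} (hN : N ≠ 0) :
    p i ∣ N ↔ decode p N i ≠ 0 := by
  rw [(hp i).dvd_iff_one_le_factorization hN, Nat.one_le_iff_ne_zero, decode]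

section Simulation

variable {ι : Type*} [DecidableEq ι] {p : ι → ℕ}

theorem decode_mul (hp : ∀ i, (p i).Prime) (hinj : p.Injective) (i : ι) {N : ℕ} (hN : N ≠ 0) :
    decode p (p i * N) = Function.update (decode p N) i (decode p N i + 1) := by
  funext j
  simp only [decode, Nat.factorization_mul (hp i).ne_zero hN, Nat.Prime.factorization (hp i),
    Finsupp.add_apply, Finsupp.single_apply, Function.update_apply, hinj.eq_iff]
  by_cases h : j = i
  · subst h; simp [add_comm]
  · simp [h, Ne.symm h]

/-- The code must stay nonzero: `0` decodes to zero counters although every prime divides it. -/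
theorem rel_of_rel_compile (hp : ∀ i, (p i).Prime) (hinj : p.Injective) {P : Prog ι} {N : ℕ}
    (hN : N ≠ 0) {c : Fin 2 → ℕ} (h : (P.compile p).Rel ![N, 0] c) :
    ∃ M, M ≠ 0 ∧ c = ![M, 0] ∧ P.Rel (decode p N) (decode p M) := by
  induction P generalizing N c with
  | skip => exact ⟨N, hN, h, rfl⟩
  | atom a =>
    obtain ⟨_ | _ | _, i⟩ := a
    · obtain ⟨h', rfl⟩ := (rel_testNotDvd (hp i).two_le).1 h
      exact ⟨N, hN, rfl, Instr.rel_zero.2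
        ⟨rfl, by simpa using mt (dvd_iff_decode_ne_zero hp i hN).2 h'⟩⟩
    · obtain ⟨M, rfl, rfl⟩ := rel_divConst.1 h
      have hM := right_ne_zero_of_mul hN
      refine ⟨M, hM, rfl, Instr.rel_dec.2 ?_⟩
      rw [decode_mul hp hinj i hM]
      simp
    · exact ⟨_, mul_ne_zero (hp i).ne_zero hN, (det_mulConst _ _ _).1 h,
        Instr.rel_inc.2 (decode_mul hp hinj i hN)⟩
  | seq P Q hP hQ =>
    obtain ⟨u, h1, h2⟩ := h
    obtain ⟨M, hM, rfl, h3⟩ := hP hN h1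
    obtain ⟨M', hM', rfl, h4⟩ := hQ hM h2
    exact ⟨M', hM', rfl, _, h3, h4⟩
  | alt P Q hP hQ =>
    rcases h with h | h
    · obtain ⟨M, hM, rfl, h'⟩ := hP hN h
      exact ⟨M, hM, rfl, .inl h'⟩
    · obtain ⟨M, hM, rfl, h'⟩ := hQ hN h
      exact ⟨M, hM, rfl, .inr h'⟩
  | star P hP =>
    change Relation.ReflTransGen _ _ _ at h
    induction h with
    | refl => exact ⟨N, hN, rfl, .refl⟩
    | tail _ h ih =>
      obtain ⟨M, hM, rfl, h1⟩ := ih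
      obtain ⟨M', hM', rfl, h2⟩ := hP hM h
      exact ⟨M', hM', rfl, .tail h1 h2⟩

theorem exists_rel_compile (hp : ∀ i, (p i).Prime) (hinj : p.Injective) {P : Prog ι} {N : ℕ}
    (hN : N ≠ 0) {t : ι → ℕ} (h : P.Rel (decode p N) t) :
    ∃ M, M ≠ 0 ∧ decode p M = t ∧ (P.compile p).Rel ![N, 0] ![M, 0] := by
  induction P generalizing N t with
  | skip => exact ⟨N, hN, h.symm, rfl⟩
  | atom a =>
    obtain ⟨_ | _ | _, i⟩ := a
    · obtain ⟨rfl, h'⟩ := Instr.rel_zero.1 h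
      exact ⟨N, hN, rfl, (rel_testNotDvd (hp i).two_le).2
        ⟨fun hd => (dvd_iff_decode_ne_zero hp i hN).1 hd h', rfl⟩⟩
    · obtain ⟨h', rfl⟩ := Instr.rel_dec.1 h
      obtain ⟨M, rfl⟩ := (dvd_iff_decode_ne_zero hp i hN).2 h'
      have hM := right_ne_zero_of_mul hN
      refine ⟨M, hM, ?_, rel_divConst.2 ⟨M, rfl, rfl⟩⟩
      rw [decode_mul hp hinj i hM]
      simp
    · rw [show t = _ from Instr.rel_inc.1 h]
      exact ⟨_, mul_ne_zero (hp i).ne_zero hN, decode_mul hp hinj i hN, (det_mulConst _ _ _).2 rfl⟩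
  | seq P Q hP hQ =>
    obtain ⟨u, h1, h2⟩ := h
    obtain ⟨M, hM, rfl, h3⟩ := hP hN h1
    obtain ⟨M', hM', rfl, h4⟩ := hQ hM h2
    exact ⟨M', hM', rfl, _, h3, h4⟩
  | alt P Q hP hQ =>
    rcases h with h | h
    · obtain ⟨M, hM, rfl, h'⟩ := hP hN h
      exact ⟨M, hM, rfl, .inl h'⟩
    · obtain ⟨M, hM, rfl, h'⟩ := hQ hN h
      exact ⟨M, hM, rfl, .inr h'⟩
  | star P hP =>
    change Relation.ReflTransGen _ _ _ at h
    induction h with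
    | refl => exact ⟨N, hN, rfl, .refl⟩
    | tail _ h ih =>
      obtain ⟨M, hM, rfl, h1⟩ := ih
      obtain ⟨M', hM', rfl, h2⟩ := hP hM h
      exact ⟨M', hM', rfl, .tail h1 h2⟩

end Simulation

/-- The prime number that encodes the counter `i`. -/
noncomputable def counterPrime {n : ℕ} (i : Fin n ⊕ ℕ) : ℕ := Nat.nth Nat.Prime (Encodable.encode i)

theorem prime_counterPrime {n : ℕ} (i : Fin n ⊕ ℕ) : (counterPrime i).Prime :=
  Nat.prime_nth_prime _

theorem counterPrime_injective {n : ℕ} : (counterPrime (n := n)).Injective :=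
  (Nat.nth_injective Nat.infinite_setOfPred_prime).comp Encodable.encode_injective

/-- Every recursively enumerable set of numbers is recognized by a regular set of two-counter
instruction sequences. -/
theorem exists_regular_language {f : ℕ → ℕ → ℕ} (hf : Primrec₂ f) :
    ∃ (L : Language (Instr (Fin 2))) (p : ℕ), L.IsRegular ∧
      ∀ n, (∃ w ∈ L, ∃ t, Exec Instr.Rel w ![p ^ n, 0] t) ↔ ∃ y, f n y = 0 := by
  obtain ⟨P, hP⟩ := exists_computes_of_primrec' (Nat.Primrec'.prim_iff₂.2 hf)
  -- The star guesses `y` in the second argument counter; the final zero test checks `f n y = 0`.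
  let Q : Prog (Fin 2 ⊕ ℕ) :=
    seq (star (atom (1, .inl 1))) (seq P (atom (0, .inr 0)))
  have hQ : ∀ n, (∃ t, Q.Rel (Sum.elim ![n, 0] 0) t) ↔ ∃ y, f n y = 0 := by
    intro n
    have hstar : ∀ t, (star (atom (1, .inl 1))).Rel (Sum.elim ![n, 0] 0 : Fin 2 ⊕ ℕ → ℕ) t ↔
        ∃ y, t = Sum.elim ![n, y] 0 := by
      intro t
      constructor
      · intro h
        change Relation.ReflTransGen _ _ _ at h
        induction h with
        | refl => exact ⟨0, rfl⟩
        | tail _ h ih =>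
          obtain ⟨y, rfl⟩ := ih
          refine ⟨y + 1, (Instr.rel_inc.1 h).trans ?_⟩
          rw [Sum.update_elim_inl, update_vec_one]
          rfl
      · rintro ⟨y, rfl⟩
        change Relation.ReflTransGen _ _ _
        induction y with
        | zero => exact .refl
        | succ y ih =>
          refine ih.tail (Instr.rel_inc.2 ?_)
          rw [Sum.update_elim_inl, update_vec_one]
          rfl
    have hget : ∀ y, (n ::ᵥ y ::ᵥ List.Vector.nil).get = ![n, y] := fun y => by
      funext i; fin_cases i <;> rfl
    have hPy : ∀ y, Det P (Sum.elim ![n, y] 0) (Sum.elim ![n, y] (Pi.single 0 (f n y))) := by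
      intro y
      simpa [hget] using hP (n ::ᵥ y ::ᵥ List.Vector.nil)
    constructor
    · rintro ⟨t, u, hu, v, hv, ht⟩
      obtain ⟨y, rfl⟩ := (hstar u).1 hu
      obtain rfl := (hPy y v).1 hv
      exact ⟨y, by simpa using (Instr.rel_zero.1 ht).2⟩
    · rintro ⟨y, hy⟩
      exact ⟨_, _, (hstar _).2 ⟨y, rfl⟩, _, (hPy y _).2 rfl, Instr.rel_zero.2 ⟨rfl, by simp [hy]⟩⟩
  refine ⟨(Q.compile counterPrime).lang, counterPrime (n := 2) (.inl 0), isRegular_lang _, fun n => ?_⟩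
  have hne := pow_ne_zero n (prime_counterPrime (n := 2) (.inl 0)).ne_zero
  have hdec : decode counterPrime (counterPrime (n := 2) (.inl 0) ^ n) = Sum.elim ![n, 0] 0 := by
    funext i
    simp only [decode, (prime_counterPrime (n := 2) (.inl 0)).factorization_pow,
      Finsupp.single_apply, counterPrime_injective.eq_iff]
    rcases i with i | i
    · fin_cases i <;> simp
    · simp
  rw [← hQ]
  constructor
  · rintro ⟨w, hw, t, h⟩
    obtain ⟨M, -, -, h⟩ := rel_of_rel_compile prime_counterPrime counterPrime_injective hne
      ((rel_iff_exists_mem_lang _).2 ⟨w, hw, h⟩)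
    exact ⟨_, hdec ▸ h⟩
  · rintro ⟨t, h⟩
    obtain ⟨M, -, -, h⟩ := exists_rel_compile prime_counterPrime counterPrime_injective hne
      (hdec.symm ▸ h)
    obtain ⟨w, hw, h⟩ := (rel_iff_exists_mem_lang _).1 h
    exact ⟨w, hw, _, h⟩

end Prog

/-! ### Executions, runs and descriptions of VASSs -/

theorem exec_map {α β S : Type*} (R : β → S → S → Prop) (f : α → β) (w : List α) (s t : S) :
    Exec R (w.map f) s t ↔ Exec (fun a => R (f a)) w s t := by
  induction w generalizing s with
  | nil => rfl
  | cons a w ih => simp only [List.map_cons, Exec, ih]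

theorem Exec.mono {α S : Type*} {R R' : α → S → S → Prop} (h : ∀ a s t, R a s t → R' a s t)
    {w : List α} {s t : S} (hw : Exec R w s t) : Exec R' w s t := by
  induction w generalizing s with
  | nil => exact hw
  | cons a w ih =>
    obtain ⟨u, h1, h2⟩ := hw
    exact ⟨u, h _ _ _ h1, ih h2⟩

theorem Exec.unique {α S : Type*} {R : α → S → S → Prop}
    (h : ∀ a s t t', R a s t → R a s t' → t = t') {w : List α} {s t t' : S}
    (hw : Exec R w s t) (hw' : Exec R w s t') : t = t' := by
  induction w generalizing s with
  | nil => exact Eq.trans hw (Eq.symm hw')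
  | cons a w ih =>
    obtain ⟨u, h1, h2⟩ := hw
    obtain ⟨u', h1', h2'⟩ := hw'
    obtain rfl := h _ _ _ _ h1 h1'
    exact ih h2 h2'

theorem Instr.Weak.unique {ι : Type*} [DecidableEq ι] {a : Instr ι} {s t t' : ι → ℕ}
    (h : a.Weak s t) (h' : a.Weak s t') : t = t' := by
  funext i
  have := h i
  have := h' i
  omega

namespace VASS

variable {k : ℕ} {α Q : Type}

theorem run_concat {V : VASS k α Q} {c c'' : VASSConfig k Q} {ρ : List (VASSTransition k α Q)}
    {t : VASSTransition k α Q} : V.Run c (ρ ++ [t]) c'' ↔ ∃ c', V.Run c ρ c' ∧ V.Step c' t c'' := by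
  constructor
  · intro h
    induction ρ generalizing c with
    | nil =>
      obtain _ | ⟨h1, _ | _⟩ := h
      exact ⟨c, .nil c, h1⟩
    | cons s ρ ih =>
      obtain _ | ⟨h1, h2⟩ := h
      obtain ⟨c', h3, h4⟩ := ih h2
      exact ⟨c', .cons h1 h3, h4⟩
  · rintro ⟨c', h, h'⟩
    induction h with
    | nil => exact .cons h' (.nil _)
    | cons h1 _ ih => exact .cons h1 (ih h')

theorem ResolvedRun.run {V : VASS k α Q}
    {r : VASSHistory k α Q → VASSConfig k Q → α → Option (VASSTransition k α Q)}
    (hr : V.IsResolver r) {w : List α} {h : VASSHistory k α Q} {c : VASSConfig k Q}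
    (H : V.ResolvedRun r w h c) :
    V.Run V.init (h.map Prod.snd) c ∧ (h.map Prod.snd).map VASSTransition.letter = w := by
  induction H with
  | nil => exact ⟨.nil _, rfl⟩
  | @snoc w h c c' a t _ h1 h2 ih =>
    rw [List.map_append, List.map_append, ih.2]
    refine ⟨run_concat.2 ⟨c, ih.1, h2⟩, ?_⟩
    simp [((hr h c a).1 t h1).1]

/-- A description of a VASS. -/
noncomputable def code {k m n : ℕ} (V : VASS k (Fin m) (Fin n)) : VASSCode k :=
  (m, n, ((V.init.1 : ℕ), V.init.2), V.final.toList.map fun f => ((f.1 : ℕ), f.2),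
    V.trans.toList.map fun t => ((t.src : ℕ), (t.letter : ℕ), t.eff, (t.tgt : ℕ)))

theorem isDescribedBy_code {k m n : ℕ} (V : VASS k (Fin m) (Fin n)) : V.IsDescribedBy V.code := by
  refine ⟨rfl, rfl, rfl, fun x => ?_, fun x => ?_⟩ <;> simp [code, eq_comm]

end VASS

/-! ### The deterministic and the history-deterministic VASS -/

/-- The modes of an automaton looking for a wrong zero test: `none` before a wrong test is found,
`some (some i)` right after a wrong test of the counter `i`, and `some none` later on. -/
abbrev CheatMode := Option (Option (Fin 2))

namespace CheatMode

/-- What the counters lack in a mode. -/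
def debt : CheatMode → Fin 2 → ℕ
  | some (some i) => Pi.single i 1
  | _ => 0

/-- The next mode if no wrong zero test is claimed. -/
def next : CheatMode → CheatMode := Option.map fun _ => none

@[simp] theorem next_eq_none {μ : CheatMode} : μ.next = none ↔ μ = none := by
  cases μ <;> simp [next]

@[simp] theorem debt_next (μ : CheatMode) : μ.next.debt = 0 := by
  cases μ <;> rfl

end CheatMode

section Automata

variable {α Q Q' : Type} [Fintype α] [Fintype Q] [Fintype Q'] (op : α → Instr (Fin 2))
  (M : DFA α Q) (e : Q' ≃ Q × CheatMode) (u₀ : Fin 2 → ℕ)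

open scoped Classical in
/-- The deterministic VASS which executes the instructions without checking the zero tests. -/
noncomputable def weakVASS : VASS 2 α Q where
  init := (M.start, u₀)
  final := (Finset.univ.filter (· ∈ M.accept)).image fun q => (q, 0)
  trans := Finset.univ.image fun x : Q × α => ⟨x.1, x.2, (op x.2).eff, M.step x.1 x.2⟩

theorem weakVASS_step {c c' : VASSConfig 2 Q} {t : VASSTransition 2 α Q} :
    (weakVASS op M u₀).Step c t c' ↔
      t = ⟨c.1, t.letter, (op t.letter).eff, c'.1⟩ ∧ c'.1 = M.step c.1 t.letter ∧
        (op t.letter).Weak c.2 c'.2 := by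
  simp only [VASS.Step, weakVASS, Finset.mem_image, Finset.mem_univ, true_and, Prod.exists]
  constructor
  · rintro ⟨⟨q, a, rfl⟩, rfl, h, h'⟩
    exact ⟨by rw [← h], h.symm, h'⟩
  · rintro ⟨h1, h2, h3⟩
    rw [h1]
    exact ⟨⟨c.1, t.letter, by rw [h2]⟩, rfl, rfl, h3⟩

theorem weakVASS_isDeterministic : (weakVASS op M u₀).IsDeterministic := by
  simp only [VASS.IsDeterministic, weakVASS, Finset.mem_image, Finset.mem_univ, true_and,
    Prod.exists]
  rintro _ ⟨q, a, rfl⟩ _ ⟨q', a', rfl⟩ rfl rfl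
  rfl

theorem weakVASS_accepting {c : VASSConfig 2 Q} :
    (weakVASS op M u₀).Accepting c ↔ c.1 ∈ M.accept := by
  simp [VASS.Accepting, weakVASS]

theorem weakVASS_run {w : List α} {c : VASSConfig 2 Q} :
    (∃ ρ, (weakVASS op M u₀).Run (M.start, u₀) ρ c ∧ ρ.map VASSTransition.letter = w) ↔
      c.1 = M.eval w ∧ Exec (fun a => (op a).Weak) w u₀ c.2 := by
  induction w using List.reverseRecOn generalizing c with
  | nil =>
    constructor
    · rintro ⟨ρ, h, hρ⟩
      obtain rfl := List.map_eq_nil_iff.1 hρ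
      obtain _ | _ := h
      exact ⟨rfl, rfl⟩
    · rintro ⟨h1, h2⟩
      obtain ⟨q, u⟩ := c
      obtain rfl : q = M.start := h1
      obtain rfl : u = u₀ := h2
      exact ⟨[], .nil _, rfl⟩
  | append_singleton w a ih =>
    rw [DFA.eval_append_singleton, exec_concat]
    constructor
    · rintro ⟨ρ, h, hρ⟩
      obtain ⟨ρ, ρ', rfl, hw, hρ'⟩ := List.map_eq_append_iff.1 hρ
      obtain ⟨t, rfl, rfl⟩ := List.map_eq_singleton_iff.1 hρ'
      obtain ⟨c', h1, h2⟩ := VASS.run_concat.1 h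
      obtain ⟨h3, h4⟩ := ih.1 ⟨ρ, h1, hw⟩
      obtain ⟨-, h5, h6⟩ := (weakVASS_step op M u₀).1 h2
      exact ⟨by rw [h5, h3], _, h4, h6⟩
    · rintro ⟨h1, u, h2, h3⟩
      obtain ⟨ρ, h4, h5⟩ := ih.2 ⟨(rfl : (M.eval w, u).1 = _), h2⟩
      refine ⟨ρ ++ [⟨M.eval w, a, (op a).eff, c.1⟩], VASS.run_concat.2 ⟨_, h4, ?_⟩, by simp [h5]⟩
      exact (weakVASS_step op M u₀).2 ⟨rfl, h1, h3⟩

theorem mem_weakVASS_language {w : List α} : w ∈ (weakVASS op M u₀).language ↔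
    w ∈ M.accepts ∧ ∃ u, Exec (fun a => (op a).Weak) w u₀ u := by
  constructor
  · rintro ⟨ρ, c, h1, h2, h3⟩
    obtain ⟨h4, h5⟩ := (weakVASS_run op M u₀).1 ⟨ρ, h1, h3⟩
    exact ⟨M.mem_accepts.2 (h4 ▸ (weakVASS_accepting op M u₀).1 h2), _, h5⟩
  · rintro ⟨h1, u, h2⟩
    obtain ⟨ρ, h3, h4⟩ := (weakVASS_run op M u₀).2 ⟨(rfl : (M.eval w, u).1 = _), h2⟩
    exact ⟨ρ, _, h3, (weakVASS_accepting op M u₀).2 (M.mem_accepts.1 h1), h4⟩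

open scoped Classical in
/-- The history-deterministic VASS which executes the instructions without checking the zero tests,
but accepts only after it has found a wrong zero test. To prove that a counter was not zero when it
was tested, it decrements the counter; the next transition restores the counter. -/
noncomputable def cheatVASS : VASS 2 α Q' where
  init := (e.symm (M.start, none), u₀)
  final := (Finset.univ.filter fun q => (e q).1 ∈ M.accept ∧ (e q).2 ≠ none).image fun q => (q, 0)
  trans :=
    (Finset.univ.image fun x : Q' × α => ⟨x.1, x.2, fun i => (op x.2).eff i + (e x.1).2.debt i,
      e.symm (M.step (e x.1).1 x.2, (e x.1).2.next)⟩) ∪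
    (Finset.univ.filter fun x : Q × α => (op x.2).1 = 0).image fun x =>
      ⟨e.symm (x.1, none), x.2, fun i => -(CheatMode.debt (some (some (op x.2).2)) i : ℤ),
        e.symm (M.step x.1 x.2, some (some (op x.2).2))⟩

/-- The true values of the counters. -/
def trueValue (c : VASSConfig 2 Q') : Fin 2 → ℕ := c.2 + (e c.1).2.debt

theorem cheatVASS_accepting {c : VASSConfig 2 Q'} :
    (cheatVASS op M e u₀).Accepting c ↔ (e c.1).1 ∈ M.accept ∧ (e c.1).2 ≠ none := by
  simp [VASS.Accepting, cheatVASS]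

/-- An ordinary transition repays the debt, and a claim of a wrong test lowers a counter while
raising its debt, so both act on the true values like the weak instruction. A claim can fire only if
the tested counter is positive, hence it is never false. -/
theorem cheatVASS_step {c c' : VASSConfig 2 Q'} {t : VASSTransition 2 α Q'}
    (h : (cheatVASS op M e u₀).Step c t c') :
    (op t.letter).Weak (trueValue e c) (trueValue e c') ∧
    (e c'.1).1 = M.step (e c.1).1 t.letter ∧
    ((e c.1).2 ≠ none → (e c'.1).2 ≠ none) ∧
    ((e c.1).2 = none → (e c'.1).2 ≠ none → ¬ (op t.letter).Rel (trueValue e c) (trueValue e c')) := by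
  obtain ⟨ht, hs, ht', h⟩ := h
  obtain ⟨q, u⟩ := c
  obtain ⟨q', u'⟩ := c'
  dsimp only at hs ht' h ⊢
  subst hs ht'
  simp only [cheatVASS, Finset.mem_union, Finset.mem_image, Finset.mem_univ, Finset.mem_filter,
    true_and, Prod.exists] at ht
  rcases ht with ⟨q, a, rfl⟩ | ⟨q, a, ha, rfl⟩
  · refine ⟨fun i => ?_, by simp, by simp, fun h1 h2 => absurd h1 (by simpa using h2)⟩
    simp only [trueValue, Pi.add_apply, Equiv.apply_symm_apply, CheatMode.debt_next, Pi.zero_apply]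
    have := h i
    dsimp only at this
    push_cast
    omega
  · have hw : (op a).Weak (trueValue e (e.symm (q, none), u))
        (trueValue e (e.symm (M.step q a, some (some (op a).2)), u')) := by
      intro i
      have := h i
      simp only [trueValue, Pi.add_apply, Equiv.apply_symm_apply, Instr.eff, ha] at this ⊢
      simp [CheatMode.debt] at this ⊢
      omega
    refine ⟨hw, by simp, by simp, fun _ _ hr => ?_⟩
    have h0 := hr.2 ha
    have h1 := h (op a).2
    simp [trueValue, CheatMode.debt] at h0 h1
    omega

/-- Repayment and instruction happen in a single transition, so a debt never blocks an instruction
that the true values allow. -/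
theorem exists_cheatVASS_step {c : VASSConfig 2 Q'} {a : α} {u : Fin 2 → ℕ}
    (h : (op a).Weak (trueValue e c) u) :
    ∃ t c', t.letter = a ∧ (cheatVASS op M e u₀).Step c t c' := by
  refine ⟨⟨c.1, a, fun i => (op a).eff i + (e c.1).2.debt i,
    e.symm (M.step (e c.1).1 a, (e c.1).2.next)⟩, (_, u), rfl, ?_, rfl, rfl, fun i => ?_⟩
  · simp only [cheatVASS, Finset.mem_union, Finset.mem_image, Finset.mem_univ, true_and]
    exact Or.inl ⟨(c.1, a), rfl⟩
  · have := h i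
    simp only [trueValue, Pi.add_apply] at this
    push_cast at this
    dsimp only
    omega

theorem exists_cheatVASS_step_ne_none {c : VASSConfig 2 Q'} {a : α} (hc : (e c.1).2 = none)
    (ha : (op a).1 = 0) (h : trueValue e c (op a).2 ≠ 0) :
    ∃ t c', t.letter = a ∧ (cheatVASS op M e u₀).Step c t c' ∧ (e c'.1).2 ≠ none := by
  obtain ⟨q, u⟩ := c
  obtain ⟨⟨q, μ⟩, rfl⟩ := e.symm.surjective q
  simp only [Equiv.apply_symm_apply] at hc
  subst hc
  refine ⟨⟨e.symm (q, none), a, fun i => -(CheatMode.debt (some (some (op a).2)) i : ℤ),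
    e.symm (M.step q a, some (some (op a).2))⟩,
    (_, u - CheatMode.debt (some (some (op a).2))), rfl, ⟨?_, rfl, rfl, fun i => ?_⟩, by simp⟩
  · simp only [cheatVASS, Finset.mem_union, Finset.mem_image, Finset.mem_univ, true_and]
    exact Or.inr ⟨(q, a), by simp [ha], rfl⟩
  · simp [trueValue, CheatMode.debt] at h ⊢
    by_cases hi : i = (op a).2
    · subst hi; simp; omega
    · simp [hi]

theorem cheatVASS_run {ρ : List (VASSTransition 2 α Q')} {c : VASSConfig 2 Q'}
    (h : (cheatVASS op M e u₀).Run (cheatVASS op M e u₀).init ρ c) :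
    Exec (fun a => (op a).Weak) (ρ.map VASSTransition.letter) u₀ (trueValue e c) ∧
    (e c.1).1 = M.eval (ρ.map VASSTransition.letter) ∧
    ((e c.1).2 ≠ none →
      ∀ x, ¬ Exec (fun a => (op a).Rel) (ρ.map VASSTransition.letter) u₀ x) := by
  induction ρ using List.reverseRecOn generalizing c with
  | nil =>
    obtain _ | _ := h
    simp [cheatVASS, Exec, trueValue, CheatMode.debt]
  | append_singleton ρ t ih =>
    obtain ⟨c', h1, h2⟩ := VASS.run_concat.1 h
    obtain ⟨h3, h4, h5⟩ := ih h1
    obtain ⟨h6, h7, -, h9⟩ := cheatVASS_step op M e u₀ h2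
    rw [List.map_append, List.map_singleton, DFA.eval_append_singleton, exec_concat]
    refine ⟨⟨_, h3, h6⟩, by rw [h7, h4], fun hc x hx => ?_⟩
    obtain ⟨v, h10, h11⟩ := exec_concat.1 hx
    by_cases hc' : (e c'.1).2 = none
    -- Weak executions are unique, so an exact execution would pass through the same true values and
    -- contradict the claim made in this step.
    · have hv : Exec (fun a => (op a).Weak) (ρ.map VASSTransition.letter) u₀ v :=
        h10.mono fun _ _ _ h => h.1
      obtain rfl := hv.unique (fun _ _ _ _ h h' => h.unique h') h3
      obtain rfl := h11.1.unique h6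
      exact h9 hc' hc h11
    · exact h5 hc' v h10

open scoped Classical in
/-- The resolver which finds a wrong zero test as soon as possible. -/
noncomputable def cheatResolver (_ : VASSHistory 2 α Q') (c : VASSConfig 2 Q') (a : α) :
    Option (VASSTransition 2 α Q') :=
  if h : ∃ t c', t.letter = a ∧ (cheatVASS op M e u₀).Step c t c' ∧ (e c'.1).2 ≠ none then
    some h.choose
  else if h : ∃ t c', t.letter = a ∧ (cheatVASS op M e u₀).Step c t c' then
    some h.choose
  else none

theorem cheatResolver_isResolver :
    (cheatVASS op M e u₀).IsResolver (cheatResolver op M e u₀) := by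
  intro h c a
  unfold cheatResolver
  split_ifs with h1 h2
  · refine ⟨?_, by simp⟩
    rintro t ⟨⟩
    obtain ⟨c', h3, h4, -⟩ := h1.choose_spec
    exact ⟨h3, c', h4⟩
  · refine ⟨?_, by simp⟩
    rintro t ⟨⟩
    obtain ⟨c', h3, h4⟩ := h2.choose_spec
    exact ⟨h3, c', h4⟩
  · exact ⟨by simp, fun _ => h2⟩

/-- Claims do not affect the true values, so the greedy resolver never gets stuck on a weakly
executable word. If it ends in mode `none`, no claim was ever possible and all tests were right. -/
theorem exists_resolvedRun {w : List α} {u : Fin 2 → ℕ}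
    (h : Exec (fun a => (op a).Weak) w u₀ u) :
    ∃ η c, (cheatVASS op M e u₀).ResolvedRun (cheatResolver op M e u₀) w η c ∧
      trueValue e c = u ∧ (e c.1).1 = M.eval w ∧
      ((e c.1).2 = none → Exec (fun a => (op a).Rel) w u₀ u) := by
  induction w using List.reverseRecOn generalizing u with
  | nil =>
    refine ⟨[], _, .nil, ?_⟩
    simp [Exec] at h
    simp [cheatVASS, Exec, trueValue, CheatMode.debt, h]
  | append_singleton w a ih =>
    obtain ⟨v, h1, h2⟩ := exec_concat.1 h
    obtain ⟨η, c, h3, rfl, h4, h5⟩ := ih h1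
    obtain ⟨t, ht⟩ : ∃ t, cheatResolver op M e u₀ η c a = some t := by
      rw [← Option.ne_none_iff_exists']
      exact fun hn => (cheatResolver_isResolver op M e u₀ η c a).2 hn
        (exists_cheatVASS_step op M e u₀ h2)
    obtain ⟨rfl, c', hc'⟩ := (cheatResolver_isResolver op M e u₀ η c a).1 t ht
    obtain ⟨h6, h7, h8, -⟩ := cheatVASS_step op M e u₀ hc'
    obtain rfl := h6.unique h2
    refine ⟨_, c', .snoc h3 ht hc', rfl, by rw [h7, h4, DFA.eval_append_singleton], fun hn => ?_⟩
    have hcn : (e c.1).2 = none := by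
      by_contra hcn
      exact h8 hcn hn
    refine exec_concat.2 ⟨_, h5 hcn, h2, fun h0 => ?_⟩
    by_contra hne
    have hcheat := exists_cheatVASS_step_ne_none op M e u₀ hcn h0 hne
    rw [cheatResolver, dif_pos hcheat] at ht
    -- The resolver's transition leads to some `c''` in a mode other than `none`; the transition
    -- fixes the target state, so `c'` has the same mode, against `hn`.
    obtain ⟨c'', -, h9, h10⟩ := hcheat.choose_spec
    rw [Option.some.inj ht] at h9
    exact h10 (by rw [← h9.2.2.1, hc'.2.2.1, hn])

theorem mem_cheatVASS_language {w : List α} : w ∈ (cheatVASS op M e u₀).language ↔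
    w ∈ M.accepts ∧ (∃ u, Exec (fun a => (op a).Weak) w u₀ u) ∧
      ∀ x, ¬ Exec (fun a => (op a).Rel) w u₀ x := by
  constructor
  · rintro ⟨ρ, c, h1, h2, rfl⟩
    obtain ⟨h3, h4, h5⟩ := cheatVASS_run op M e u₀ h1
    obtain ⟨h6, h7⟩ := (cheatVASS_accepting op M e u₀).1 h2
    exact ⟨M.mem_accepts.2 (h4 ▸ h6), ⟨_, h3⟩, h5 h7⟩
  · rintro ⟨h1, ⟨u, h2⟩, h3⟩
    obtain ⟨η, c, h4, -, h5, h6⟩ := exists_resolvedRun op M e u₀ h2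
    obtain ⟨h7, h8⟩ := h4.run (cheatResolver_isResolver op M e u₀)
    exact ⟨_, c, h7, (cheatVASS_accepting op M e u₀).2
      ⟨h5 ▸ M.mem_accepts.1 h1, fun hn => h3 _ (h6 hn)⟩, h8⟩

theorem cheatVASS_isHistoryDeterministic : (cheatVASS op M e u₀).IsHistoryDeterministic := by
  refine ⟨_, cheatResolver_isResolver op M e u₀, fun w hw => ?_⟩
  obtain ⟨h1, ⟨u, h2⟩, h3⟩ := (mem_cheatVASS_language op M e u₀).1 hw
  obtain ⟨η, c, h4, -, h5, h6⟩ := exists_resolvedRun op M e u₀ h2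
  exact ⟨η, c, h4, (cheatVASS_accepting op M e u₀).2
    ⟨h5 ▸ M.mem_accepts.1 h1, fun hn => h3 _ (h6 hn)⟩⟩

/-- The two languages differ exactly in the accepted words that execute with all zero tests right.
-/
theorem weakVASS_language_eq_iff :
    (weakVASS op M u₀).language = (cheatVASS op M e u₀).language ↔
      ¬ ∃ w ∈ M.accepts, ∃ x, Exec (fun a => (op a).Rel) w u₀ x := by
  constructor
  · rintro h ⟨w, hw, x, hx⟩
    have : w ∈ (weakVASS op M u₀).language :=
      (mem_weakVASS_language op M u₀).2 ⟨hw, x, hx.mono fun _ _ _ h => h.1⟩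
    rw [h] at this
    exact ((mem_cheatVASS_language op M e u₀).1 this).2.2 x hx
  · intro h
    ext w
    rw [mem_weakVASS_language, mem_cheatVASS_language]
    exact ⟨fun ⟨h1, h2⟩ => ⟨h1, h2, fun x hx => h ⟨w, h1, x, hx⟩⟩, fun ⟨h1, h2, _⟩ => ⟨h1, h2⟩⟩

end Automata

/-! ### Computability of the reduction and undecidability -/

theorem computable_vec_pow (p : ℕ) : Computable fun n : ℕ => ![p ^ n, 0] := by
  have hpow : Primrec fun n : ℕ => p ^ n :=
    (Primrec.nat_iterate Primrec.id (Primrec.const 1)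
      ((Primrec.nat_mul.comp (Primrec.const p) Primrec.snd).to₂)).of_eq fun n => by
        simp [mul_left_iterate]
  refine Primrec.to_comp ((Primrec.fin_curry (f := fun (n : ℕ) (i : Fin 2) => ![p ^ n, 0] i)).2
    (show Primrec fun x : ℕ × Fin 2 => ![p ^ x.1, 0] x.2 from ?_))
  refine (Primrec.ite (c := fun x : ℕ × Fin 2 => x.2 = 0)
    (Primrec.eq.comp Primrec.snd (Primrec.const 0)) (hpow.comp Primrec.fst)
    (Primrec.const 0)).of_eq ?_
  rintro ⟨n, i⟩
  fin_cases i <;> simp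

/-- Only the initial counter values vary with `b`. The two lists are constants, so the noncomputable
choice of their order is harmless. -/
theorem computable_code {β : Type*} [Primcodable β] {k m n : ℕ} {u : β → Fin k → ℕ}
    (hu : Computable u) (q : Fin n) (F : Finset (VASSConfig k (Fin n)))
    (T : Finset (VASSTransition k (Fin m) (Fin n))) :
    Computable fun b => (VASS.mk (q, u b) F T).code := by
  unfold VASS.code
  dsimp only
  generalize F.toList.map _ = F'
  generalize T.toList.map _ = T'
  exact (Computable.const m).pair ((Computable.const n).pair
    (((Computable.const (q : ℕ)).pair hu).pair ((Computable.const F').pair (Computable.const T'))))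

/-- Zero if the program with number `n` halts on input zero within `y` steps, and one otherwise. -/
def notHaltedBy (n y : ℕ) : ℕ :=
  bif ((Denumerable.ofNat Nat.Partrec.Code n).evaln y 0).isSome then 0 else 1

theorem notHaltedBy_primrec : Primrec₂ notHaltedBy := by
  refine Primrec.to₂ (Primrec.cond (Primrec.option_isSome.comp
    (Nat.Partrec.Code.primrec_evaln.comp ((Primrec.snd.pair
      ((Primrec.ofNat _).comp Primrec.fst)).pair (Primrec.const 0))))
    (Primrec.const 0) (Primrec.const 1))

theorem exists_notHaltedBy_eq_zero (c : Nat.Partrec.Code) :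
    (∃ y, notHaltedBy (Encodable.encode c) y = 0) ↔ (c.eval 0).Dom := by
  simp only [Part.dom_iff_mem, Nat.Partrec.Code.evaln_complete, notHaltedBy,
    Denumerable.ofNat_encode]
  rw [exists_comm]
  refine exists_congr fun y => ?_
  cases h : c.evaln y 0 <;> simp

theorem corollary3 :
    ¬ ∃ f : VASSCode 2 × VASSCode 2 →. Bool, Partrec f ∧
      ∀ (m n₁ n₂ : ℕ) (A : VASS 2 (Fin m) (Fin n₁)) (B : VASS 2 (Fin m) (Fin n₂))
        (a b : VASSCode 2), A.IsDescribedBy a → B.IsDescribedBy b →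
        A.IsDeterministic → B.IsHistoryDeterministic →
        ∃ answer : Bool, answer ∈ f (a, b) ∧ (answer = true ↔ A.language = B.language) := by
  rintro ⟨f, hf, hcorrect⟩
  obtain ⟨L, p, ⟨σ, _, M, rfl⟩, hL⟩ := Prog.exists_regular_language notHaltedBy_primrec
  obtain ⟨m, ⟨op⟩⟩ : ∃ m, Nonempty (Fin m ≃ Instr (Fin 2)) := ⟨_, ⟨(Fintype.equivFin _).symm⟩⟩
  obtain ⟨n, N, hN⟩ : ∃ (n : ℕ) (N : DFA (Fin m) (Fin n)), ∀ w, w ∈ N.accepts ↔ w.map op ∈ M.accepts :=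
    ⟨_, (DFA.reindex (Fintype.equivFin σ) M).comap op, fun w => by
      rw [DFA.accepts_comap, DFA.accepts_reindex]; rfl⟩
  obtain ⟨n', ⟨e⟩⟩ : ∃ n', Nonempty (Fin n' ≃ Fin n × CheatMode) :=
    ⟨_, ⟨(Fintype.equivFin _).symm⟩⟩
  let u (c : Nat.Partrec.Code) : Fin 2 → ℕ := ![p ^ Encodable.encode c, 0]
  have hlang : ∀ c, (weakVASS op N (u c)).language = (cheatVASS op N e (u c)).language ↔
      ¬ (c.eval 0).Dom := by
    intro c
    rw [weakVASS_language_eq_iff, ← exists_notHaltedBy_eq_zero, ← hL]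
    refine not_congr ⟨?_, ?_⟩
    · rintro ⟨w, hw, x, hx⟩
      exact ⟨w.map op, (hN w).1 hw, x, (exec_map _ _ _ _ _).2 hx⟩
    · rintro ⟨w, hw, x, hx⟩
      have hmap : (w.map op.symm).map op = w := by simp
      exact ⟨w.map op.symm, (hN _).2 (hmap.symm ▸ hw), x,
        (exec_map _ _ _ _ _).1 (hmap.symm ▸ hx)⟩
  have hu : Computable u := (computable_vec_pow p).comp Computable.encode
  have hA : Computable fun c => (weakVASS op N (u c)).code :=
    computable_code hu _ _ _
  have hB : Computable fun c => (cheatVASS op N e (u c)).code :=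
    computable_code hu _ _ _
  have key : ∀ c, ∃ answer : Bool,
      answer ∈ f ((weakVASS op N (u c)).code, (cheatVASS op N e (u c)).code) ∧
        (answer = true ↔ ¬ (c.eval 0).Dom) := by
    intro c
    rw [← hlang]
    exact hcorrect _ _ _ _ _ _ _ (VASS.isDescribedBy_code _) (VASS.isDescribedBy_code _)
      (weakVASS_isDeterministic op N (u c)) (cheatVASS_isHistoryDeterministic op N e (u c))
  -- The partial `f` is defined on every pair that the reduction produces, so the composition is a
  -- total computable function `g`, and its negation would decide halting on input `0`.
  choose g hg hg' using key
  have hgc : Computable g := (hf.comp (hA.pair hB)).of_eq_tot hg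
  refine ComputablePred.halting_problem 0 (ComputablePred.computable_iff.2
    ⟨fun c => !g c, Primrec.not.to_comp.comp hgc, funext fun c => propext ?_⟩)
  have := hg' c
  cases h : g c <;> simp_all
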